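/- Let $M$ be a smooth manifold of dimension $n\ge 2$, $\alpha=\sqrt{a_{ij}(x)y^iy^j}$ a smooth Riemannian metric and $\beta=b_i(x)y^i$ a smooth 1-form on $M$, let $c_1,c_2,c_3\in\mathbb R$, and suppose that $F=c_1\alpha+c_2\beta+c_3\beta^2/\alpha$ is a Finsler metric on $M$ (nonnegative, $C^\infty$ on $TM\setminus 0$, positively $1$-homogeneous on the fibres, with $\mathbf g_y(u,v)=\tfrac12\frac{\partial^2}{\partial s\,\partial t}F^2(y+su+tv)|_{s=t=0}$ positive definite for every $y\neq0$). Let $\mathbf C_y(u,v,w)=\tfrac12\frac{d}{dt}\mathbf g_{y+tw}(u,v)|_{t=0}$ be the Cartan torsion, and, in components with respect to an arbitrary basis of $T_xM$, $I_i=g^{jk}C_{ijk}$ the mean Cartan torsion. Write $\|\mathbf C\|=\sqrt{g^{il}g^{jm}g^{kr}C_{ijk}C_{lmr}}$ and $\|\mathbf I\|=\sqrt{g^{ij}I_iI_j}$ for their pointwise norms at $(x,y)$, $y\ne0$. Put $s=\beta/\alpha$, $b^2=a^{ij}b_ib_j$ and $$A=\frac{2(n-2)c_3s}{c_1-c_3s^2}-\frac{(n+1)(c_2+2c_3s)}{c_1+c_2s+c_3s^2}+\frac{6c_3s}{(c_1-c_3s^2)+2(b^2-s^2)c_3}.$$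 Then, at every $(x,y)$ with $y\neq 0$: 1. the three denominators in $A$ are nonzero, and $A\ne0$ whenever $\|\mathbf I\|\neq0$; 2. if $A\neq0$, then $$\|\mathbf C\|=\sqrt{\frac{3p^2+6pq+(n+1)q^2}{n+1}}\;\|\mathbf I\|,\qquad p=\frac{n+1}{(c_1-c_3s^2)(c_1+c_2s+c_3s^2)A}\Big[3c_2c_3s^2+4c_3^2s^3-c_1c_2\Big],\quad q=1-p;$$ 3. in particular, for a Randers metric ($c_3=0$) one has $\|\mathbf C\|=\sqrt{\tfrac{3}{n+1}}\;\|\mathbf I\|$, and if moreover $c_2\neq0$ then $A\neq0$ and $p=1$. -/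

import Mathlib

open scoped Manifold ContDiff

noncomputable section

/-- A Finsler metric on a smooth `n`-manifold `M`: a nonnegative function on the tangent bundle,
smooth off the zero section, positively homogeneous of degree one on the fibres, and such that
`g_y(u,v) = (1/2) ∂²/∂s∂t F²(y + s u + t v)` at `s = t = 0` is positive definite for `y ≠ 0`. -/
structure FinslerMetric (n : ℕ) (M : Type*) [TopologicalSpace M]
    [ChartedSpace (EuclideanSpace ℝ (Fin n)) M] [IsManifold (𝓡 n) ∞ M] where
  toFun : (x : M) → TangentSpace (𝓡 n) x → ℝ
  nonneg : ∀ x y, 0 ≤ toFun x y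
  smooth : ContMDiffOn (𝓡 n).tangent 𝓘(ℝ) ∞
    (fun v : TangentBundle (𝓡 n) M => toFun v.proj v.snd) {v | v.snd ≠ 0}
  homogeneous : ∀ (x : M) (y : TangentSpace (𝓡 n) x) (r : ℝ), 0 < r →
    toFun x (r • y) = r * toFun x y
  posDef : ∀ (x : M) (y u : TangentSpace (𝓡 n) x), y ≠ 0 → u ≠ 0 →
    0 < (1 / 2 : ℝ) *
      deriv (fun s : ℝ => deriv (fun t : ℝ => toFun x (y + s • u + t • u) ^ 2) 0) 0

/-- A smooth Riemannian metric on `M`. -/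
abbrev SmoothMetric (n : ℕ) (M : Type*) [TopologicalSpace M]
    [ChartedSpace (EuclideanSpace ℝ (Fin n)) M] [IsManifold (𝓡 n) ∞ M] :=
  Bundle.ContMDiffRiemannianMetric (𝓡 n) ∞ (EuclideanSpace ℝ (Fin n))
    (fun x : M => TangentSpace (𝓡 n) x)

/-- A smooth 1-form on `M`: a smooth section of the cotangent bundle. -/
abbrev SmoothOneForm (n : ℕ) (M : Type*) [TopologicalSpace M]
    [ChartedSpace (EuclideanSpace ℝ (Fin n)) M] [IsManifold (𝓡 n) ∞ M] :=
  ContMDiffSection (𝓡 n) (EuclideanSpace ℝ (Fin n) →L[ℝ] ℝ) ∞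
    (fun x : M => TangentSpace (𝓡 n) x →L[ℝ] Bundle.Trivial M ℝ x)

section Manifold

variable {n : ℕ} {M : Type*} [TopologicalSpace M]
  [ChartedSpace (EuclideanSpace ℝ (Fin n)) M] [IsManifold (𝓡 n) ∞ M]

/-- `α(x,y) = √(a_ij(x) yⁱ yʲ)`. -/
def SmoothMetric.alpha (a : SmoothMetric n M) (x : M) (y : TangentSpace (𝓡 n) x) : ℝ :=
  Real.sqrt (a.inner x y y)

/-- `β(x,y) = b_i(x) yⁱ` as a real number. -/
def SmoothOneForm.eval (β : SmoothOneForm n M) (x : M) (y : TangentSpace (𝓡 n) x) : ℝ :=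
  β x y

/-- `b² = a^{ij} b_i b_j`, components taken in the basis `e` of `T_xM`. -/
def SmoothOneForm.normSq (a : SmoothMetric n M) (β : SmoothOneForm n M) (x : M)
    (e : Module.Basis (Fin n) ℝ (TangentSpace (𝓡 n) x)) : ℝ :=
  ∑ i, ∑ j, (Matrix.of fun k l => a.inner x (e k) (e l))⁻¹ i j *
    β.eval x (e i) * β.eval x (e j)

namespace FinslerMetric

variable (F : FinslerMetric n M) (x : M)

/-- The fundamental form `g_y(u,v)`. -/
def fundamental (y u v : TangentSpace (𝓡 n) x) : ℝ :=
  (1 / 2) * deriv (fun s : ℝ => deriv (fun t : ℝ => F.toFun x (y + s • u + t • v) ^ 2) 0) 0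

/-- The Cartan torsion `C_y(u,v,w) = (1/2) d/dt g_{y+tw}(u,v)` at `t = 0`. -/
def cartan (y u v w : TangentSpace (𝓡 n) x) : ℝ :=
  (1 / 2) * deriv (fun t : ℝ => F.fundamental x (y + t • w) u v) 0

variable (e : Module.Basis (Fin n) ℝ (TangentSpace (𝓡 n) x))

/-- The inverse matrix `g^{ij}(y)` of `g_ij(y) = g_y(e_i, e_j)`. -/
def gInv (y : TangentSpace (𝓡 n) x) : Matrix (Fin n) (Fin n) ℝ :=
  (Matrix.of fun i j => F.fundamental x y (e i) (e j))⁻¹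

/-- The components `I_i = g^{jk} C_ijk` of the mean Cartan torsion in the basis `e`. -/
def meanCartan (y : TangentSpace (𝓡 n) x) (i : Fin n) : ℝ :=
  ∑ j, ∑ k, F.gInv x e y j k * F.cartan x y (e i) (e j) (e k)

/-- `‖I_y‖ = √(g^{ij} I_i I_j)`. -/
def meanCartanNorm (y : TangentSpace (𝓡 n) x) : ℝ :=
  Real.sqrt (∑ i, ∑ j, F.gInv x e y i j * F.meanCartan x e y i * F.meanCartan x e y j)

/-- `‖C_y‖ = √(g^{il} g^{jm} g^{kr} C_ijk C_lmr)`. -/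
def cartanNorm (y : TangentSpace (𝓡 n) x) : ℝ :=
  Real.sqrt (∑ i, ∑ j, ∑ k, ∑ l, ∑ m, ∑ r,
    F.gInv x e y i l * F.gInv x e y j m * F.gInv x e y k r *
      F.cartan x y (e i) (e j) (e k) * F.cartan x y (e l) (e m) (e r))

end FinslerMetric

end Manifold

/-- The scalar `A` for `φ(s) = c₁ + c₂ s + c₃ s²`; the arguments `bSq`, `s` are `b²` and `β/α`. -/
def coeffA (n : ℕ) (c₁ c₂ c₃ bSq s : ℝ) : ℝ :=
  2 * ((n : ℝ) - 2) * c₃ * s / (c₁ - c₃ * s ^ 2)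
    - ((n : ℝ) + 1) * (c₂ + 2 * c₃ * s) / (c₁ + c₂ * s + c₃ * s ^ 2)
    + 6 * c₃ * s / ((c₁ - c₃ * s ^ 2) + 2 * (bSq - s ^ 2) * c₃)

/-- The scalar `p` for `φ(s) = c₁ + c₂ s + c₃ s²`. -/
def coeffP (n : ℕ) (c₁ c₂ c₃ bSq s : ℝ) : ℝ :=
  ((n : ℝ) + 1) /
      ((c₁ - c₃ * s ^ 2) * (c₁ + c₂ * s + c₃ * s ^ 2) * coeffA n c₁ c₂ c₃ bSq s) *
    (3 * c₂ * c₃ * s ^ 2 + 4 * c₃ ^ 2 * s ^ 3 - c₁ * c₂)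

end

noncomputable section

namespace AlphaBeta

variable {V : Type*} [AddCommGroup V] [Module ℝ V]

/-! Everything happens in one fibre, so `a` becomes a positive definite form and `β` a linear
functional `b` on a vector space. Let `x_i` be `α ∂_i s` (`ratioD`), `f_i = ∂_i F` (`metricD`), `h =
g - f f` the angular form of `F`, `ψ = c₁ - c₃s²`, `φ = F/α` and `Δ = ψ + 2(b² - s²)c₃`.
Differentiating `F²` three times (`cartanForm_metric`) and eliminating the angular form of `α` in
favour of `h` shows that the Cartan torsion is semi-C-reducible: `C = P (h x + h x + h x) + Q x x
x`. Since `y/F` is dual to `f`, is `g`-unit and kills `x`, contraction (`sum_semiCReducible`) gives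
`I = λ x` with `λ = (n+1)P + Qτ`, where `τ = g^{ij} x_i x_j = (b² - s²)/(φΔ)`, and it gives `‖C‖²`
as `τ` times a quadratic polynomial in `P` and `Qτ`. Finally `λ = -A/(2α)` (`coeffA_eq`), so `p =
(n+1)P/λ` and `q = Qτ/λ`, and the ratio of the norms follows. The denominators are positive because
`g` is: `phi_pos`, `detFactor_pos`, `phi_sub_pos`. -/

/-- The norm `α(y) = √a(y,y)` of a bilinear form. -/
def formNorm (a : LinearMap.BilinForm ℝ V) (y : V) : ℝ := Real.sqrt (a y y)

/-- The derivative of `α` at `y` in the direction `u`. -/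
def normD (a : LinearMap.BilinForm ℝ V) (y u : V) : ℝ := a y u / formNorm a y

/-- The ratio `s = β/α`. -/
def ratio (a : LinearMap.BilinForm ℝ V) (b : V →ₗ[ℝ] ℝ) (y : V) : ℝ := b y / formNorm a y

/-- `α` times the derivative of `s = β/α`. -/
def ratioD (a : LinearMap.BilinForm ℝ V) (b : V →ₗ[ℝ] ℝ) (y u : V) : ℝ :=
  b u - ratio a b y * normD a y u

/-- `α` times the second derivative of `α`. -/
def angular (a : LinearMap.BilinForm ℝ V) (y u v : V) : ℝ :=
  a u v - normD a y u * normD a y v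

/-- The `(α,β)`-metric `c₁α + c₂β + c₃β²/α`. -/
def metric (a : LinearMap.BilinForm ℝ V) (b : V →ₗ[ℝ] ℝ) (c₁ c₂ c₃ : ℝ) (y : V) : ℝ :=
  c₁ * formNorm a y + c₂ * b y + c₃ * b y ^ 2 / formNorm a y

/-- The derivative of `metric` at `y` in the direction `u`. -/
def metricD (a : LinearMap.BilinForm ℝ V) (b : V →ₗ[ℝ] ℝ) (c₁ c₂ c₃ : ℝ) (y u : V) : ℝ :=
  (c₁ - c₃ * ratio a b y ^ 2) * normD a y u + (c₂ + 2 * c₃ * ratio a b y) * b u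

/-- The quotient `φ(s) = F/α`. -/
def phi (a : LinearMap.BilinForm ℝ V) (b : V →ₗ[ℝ] ℝ) (c₁ c₂ c₃ : ℝ) (y : V) : ℝ :=
  c₁ + c₂ * ratio a b y + c₃ * ratio a b y ^ 2

/-- The angular form `F ∂²F` of `metric`. -/
def angularF (a : LinearMap.BilinForm ℝ V) (b : V →ₗ[ℝ] ℝ) (c₁ c₂ c₃ : ℝ) (y u v : V) : ℝ :=
  phi a b c₁ c₂ c₃ y * ((c₁ - c₃ * ratio a b y ^ 2) * angular a y u v
    + 2 * c₃ * ratioD a b y u * ratioD a b y v)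

/-- The half of the Hessian of the square of `L`, by iterated one-variable derivatives. -/
def halfHessSq (L : V → ℝ) (y u v : V) : ℝ :=
  (1 / 2) * deriv (fun s : ℝ => deriv (fun t : ℝ => L (y + s • u + t • v) ^ 2) 0) 0

/-- The half of the derivative of `halfHessSq`. -/
def cartanForm (L : V → ℝ) (y u v w : V) : ℝ :=
  (1 / 2) * deriv (fun t : ℝ => halfHessSq L (y + t • w) u v) 0

/-! ### Derivatives along lines: the fundamental form and the Cartan torsion. -/

section Calculus

variable {a : LinearMap.BilinForm ℝ V} (hsymm : ∀ u v, a u v = a v u)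
  (hpos : ∀ u, u ≠ 0 → 0 < a u u) (b : V →ₗ[ℝ] ℝ) (c₁ c₂ c₃ : ℝ)

theorem formNorm_pos (hpos : ∀ u, u ≠ 0 → 0 < a u u) {y : V} (hy : y ≠ 0) : 0 < formNorm a y :=
  Real.sqrt_pos.2 (hpos y hy)

theorem formNorm_sq (hpos : ∀ u, u ≠ 0 → 0 < a u u) {y : V} (hy : y ≠ 0) :
    formNorm a y ^ 2 = a y y :=
  Real.sq_sqrt (hpos y hy).le

theorem hasDerivAt_line (b : V →ₗ[ℝ] ℝ) (y w : V) :
    HasDerivAt (fun t : ℝ => b (y + t • w)) (b w) 0 := by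
  have h : HasDerivAt (fun t : ℝ => b y + t * b w) (1 * b w) 0 :=
    ((hasDerivAt_id (0 : ℝ)).mul_const (b w)).const_add _
  simpa using h

include hsymm hpos

theorem hasDerivAt_formNorm {y : V} (hy : y ≠ 0) (w : V) :
    HasDerivAt (fun t : ℝ => formNorm a (y + t • w)) (normD a y w) 0 := by
  have h1 : HasDerivAt (fun t : ℝ => a (y + t • w) (y + t • w)) (2 * a y w) 0 := by
    have h : HasDerivAt (fun t : ℝ => a y y + t * (2 * a y w) + t ^ 2 * a w w)
        (1 * (2 * a y w) + (2 * (0 : ℝ) ^ 1 * 1) * a w w) 0 :=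
      (((hasDerivAt_id (0 : ℝ)).mul_const _).const_add _).add
        (((hasDerivAt_id (0 : ℝ)).pow 2).mul_const _)
    refine (h.congr_deriv (by ring)).congr_of_eventuallyEq (.of_forall fun t => ?_)
    · simp only [map_add, map_smul, LinearMap.add_apply, LinearMap.smul_apply, smul_eq_mul,
        hsymm w y]
      ring
  have h2 := h1.sqrt (by simpa using (hpos y hy).ne')
  have h0 := formNorm_pos hpos hy
  refine h2.congr_deriv ?_
  simp only [normD, formNorm, zero_smul, add_zero]
  rw [mul_div_mul_left _ _ two_ne_zero]

theorem hasDerivAt_ratio {y : V} (hy : y ≠ 0) (w : V) :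
    HasDerivAt (fun t : ℝ => ratio a b (y + t • w)) (ratioD a b y w / formNorm a y) 0 := by
  have h0 := (formNorm_pos hpos hy).ne'
  have h := (hasDerivAt_line b y w).div (hasDerivAt_formNorm hsymm hpos hy w)
    (by simpa using h0)
  refine h.congr_deriv ?_
  simp only [zero_smul, add_zero, ratioD, ratio]
  field_simp

theorem hasDerivAt_normD {y : V} (hy : y ≠ 0) (u w : V) :
    HasDerivAt (fun t : ℝ => normD a (y + t • w) u) (angular a y w u / formNorm a y) 0 := by
  have h0 := (formNorm_pos hpos hy).ne'
  have h := (hasDerivAt_line (a.flip u) y w).div (hasDerivAt_formNorm hsymm hpos hy w)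
    (by simpa using h0)
  refine h.congr_deriv ?_
  simp only [zero_smul, add_zero, angular, normD, show ∀ v, a.flip u v = a v u from fun _ => rfl]
  field_simp

theorem hasDerivAt_ratioD {y : V} (hy : y ≠ 0) (u w : V) :
    HasDerivAt (fun t : ℝ => ratioD a b (y + t • w) u)
      (-(ratioD a b y w * normD a y u + ratio a b y * angular a y w u) / formNorm a y) 0 := by
  have h := ((hasDerivAt_ratio hsymm hpos b hy w).mul
    (hasDerivAt_normD hsymm hpos hy u w)).const_sub (b u)
  refine h.congr_deriv ?_
  simp only [zero_smul, add_zero]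
  ring

theorem hasDerivAt_angular {y : V} (hy : y ≠ 0) (u v w : V) :
    HasDerivAt (fun t : ℝ => angular a (y + t • w) u v)
      (-(angular a y w u * normD a y v + normD a y u * angular a y w v) / formNorm a y) 0 := by
  have h := ((hasDerivAt_normD hsymm hpos hy u w).mul
    (hasDerivAt_normD hsymm hpos hy v w)).const_sub (a u v)
  refine h.congr_deriv ?_
  simp only [zero_smul, add_zero]
  ring

theorem hasDerivAt_metric {y : V} (hy : y ≠ 0) (w : V) :
    HasDerivAt (fun t : ℝ => metric a b c₁ c₂ c₃ (y + t • w)) (metricD a b c₁ c₂ c₃ y w) 0 := by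
  have h0 := (formNorm_pos hpos hy).ne'
  have hn := hasDerivAt_formNorm hsymm hpos hy w
  have hb := hasDerivAt_line b y w
  have h := ((hn.const_mul c₁).add (hb.const_mul c₂)).add
    (((hb.pow 2).const_mul c₃).div hn (by simpa using h0))
  refine h.congr_deriv ?_
  simp only [zero_smul, add_zero, metricD, ratio]
  field_simp
  norm_num
  ring

theorem hasDerivAt_phi {y : V} (hy : y ≠ 0) (w : V) :
    HasDerivAt (fun t : ℝ => phi a b c₁ c₂ c₃ (y + t • w))
      ((c₂ + 2 * c₃ * ratio a b y) * ratioD a b y w / formNorm a y) 0 := by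
  have hs := hasDerivAt_ratio hsymm hpos b hy w
  have h := ((hs.const_mul c₂).const_add c₁).add ((hs.pow 2).const_mul c₃)
  refine h.congr_deriv ?_
  simp only [zero_smul, add_zero]
  norm_num
  ring

theorem hasDerivAt_metricD {y : V} (hy : y ≠ 0) (u w : V) :
    HasDerivAt (fun t : ℝ => metricD a b c₁ c₂ c₃ (y + t • w) u)
      (((c₁ - c₃ * ratio a b y ^ 2) * angular a y w u
        + 2 * c₃ * ratioD a b y w * ratioD a b y u) / formNorm a y) 0 := by
  have hs := hasDerivAt_ratio hsymm hpos b hy w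
  have h := ((((hs.pow 2).const_mul c₃).const_sub c₁).mul
    (hasDerivAt_normD hsymm hpos hy u w)).add
    (((hs.const_mul (2 * c₃)).const_add c₂).mul_const (b u))
  refine h.congr_deriv ?_
  simp only [zero_smul, add_zero]
  rw [show b u = ratioD a b y u + ratio a b y * normD a y u by simp [ratioD]]
  norm_num
  ring

/-- The derivative formulas hold only off the origin; this lets them be substituted under an outer
`deriv`, which sees only nearby parameters. -/
theorem eventually_line_ne_zero {y : V} (hy : y ≠ 0) (w : V) :
    ∀ᶠ t : ℝ in nhds 0, y + t • w ≠ 0 := by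
  have h := (hasDerivAt_formNorm hsymm hpos hy w).continuousAt
  have h1 : formNorm a (y + (0 : ℝ) • w) ≠ 0 := by simpa using (formNorm_pos hpos hy).ne'
  filter_upwards [h.eventually_ne h1] with t ht h2
  simp [h2, formNorm] at ht

omit hsymm in
theorem metric_eq {y : V} (hy : y ≠ 0) :
    metric a b c₁ c₂ c₃ y = phi a b c₁ c₂ c₃ y * formNorm a y := by
  have h0 := (formNorm_pos hpos hy).ne'
  simp only [metric, phi, ratio]
  field_simp

theorem halfHessSq_metric {y : V} (hy : y ≠ 0) (u v : V) :
    halfHessSq (metric a b c₁ c₂ c₃) y u v =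
      metricD a b c₁ c₂ c₃ y u * metricD a b c₁ c₂ c₃ y v + angularF a b c₁ c₂ c₃ y u v := by
  have h0 := (formNorm_pos hpos hy).ne'
  have h1 : ∀ᶠ s : ℝ in nhds 0,
      deriv (fun t : ℝ => metric a b c₁ c₂ c₃ (y + s • u + t • v) ^ 2) 0 =
        2 * (metric a b c₁ c₂ c₃ (y + s • u) * metricD a b c₁ c₂ c₃ (y + s • u) v) := by
    filter_upwards [eventually_line_ne_zero hsymm hpos hy u] with s hs
    refine (((hasDerivAt_metric hsymm hpos b c₁ c₂ c₃ hs v).pow 2).congr_deriv ?_).deriv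
    simp
    ring
  have h2 := ((hasDerivAt_metric hsymm hpos b c₁ c₂ c₃ hy u).mul
    (hasDerivAt_metricD hsymm hpos b c₁ c₂ c₃ hy v u)).const_mul 2
  have h3 := h2.congr_of_eventuallyEq h1
  rw [halfHessSq, h3.deriv]
  simp only [zero_smul, add_zero, angularF, metric_eq hpos b c₁ c₂ c₃ hy]
  field_simp

/-- With `φ(s) = c₁ + c₂s + c₃s²`, the two coefficients are `φφ' - s(φφ'' + φ'²)` and `3φ'φ''`. -/
theorem cartanForm_metric {y : V} (hy : y ≠ 0) (u v w : V) :
    cartanForm (metric a b c₁ c₂ c₃) y u v w =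
      1 / (2 * formNorm a y) * ((c₁ * c₂ - 3 * c₂ * c₃ * ratio a b y ^ 2
          - 4 * c₃ ^ 2 * ratio a b y ^ 3) *
        (angular a y u v * ratioD a b y w + angular a y v w * ratioD a b y u
          + angular a y w u * ratioD a b y v)
        + 6 * c₃ * (c₂ + 2 * c₃ * ratio a b y)
          * (ratioD a b y u * ratioD a b y v * ratioD a b y w)) := by
  have h0 := (formNorm_pos hpos hy).ne'
  have h1 : ∀ᶠ t : ℝ in nhds 0,
      halfHessSq (metric a b c₁ c₂ c₃) (y + t • w) u v =
        metricD a b c₁ c₂ c₃ (y + t • w) u * metricD a b c₁ c₂ c₃ (y + t • w) v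
          + angularF a b c₁ c₂ c₃ (y + t • w) u v := by
    filter_upwards [eventually_line_ne_zero hsymm hpos hy w] with t ht
    exact halfHessSq_metric hsymm hpos b c₁ c₂ c₃ ht u v
  have hD := hasDerivAt_metricD hsymm hpos b c₁ c₂ c₃ hy
  have hs := hasDerivAt_ratio hsymm hpos b hy w
  have hX := hasDerivAt_ratioD hsymm hpos b hy
  have h2 := ((hD u w).mul (hD v w)).add ((hasDerivAt_phi hsymm hpos b c₁ c₂ c₃ hy w).mul
    (((((hs.pow 2).const_mul c₃).const_sub c₁).mul (hasDerivAt_angular hsymm hpos hy u v w)).add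
      (((hX u w).const_mul (2 * c₃)).mul (hX v w))))
  have h3 := h2.congr_of_eventuallyEq h1
  rw [cartanForm, h3.deriv]
  have hk : angular a y v w = angular a y w v := by simp [angular, hsymm v w, mul_comm]
  -- Splitting `b` into its `ratioD` and `normD` parts makes every term that contains a bare `normD`
  -- cancel.
  simp only [zero_smul, add_zero, Pi.add_apply, Pi.mul_apply, Pi.pow_apply, hk, metricD, phi,
    show ∀ u, b u = ratioD a b y u + ratio a b y * normD a y u by simp [ratioD]]
  norm_num
  field_simp
  ring

end Calculus

/-! ### Contractions of a semi-C-reducible tensor. -/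

section Contraction

variable {ι : Type*} [Fintype ι] [DecidableEq ι]

/-- Contractions of a semi-C-reducible tensor `P (h x + h x + h x) + Q x x x`, where
`h = G - f f` and `f`, `x` are orthogonal for `G⁻¹` with `f` of norm one. -/
theorem sum_semiCReducible {G : Matrix ι ι ℝ} (hG : ∀ i j, G i j = G j i) (hdet : G.det ≠ 0)
    {f x l : ι → ℝ} (hl : ∀ i, ∑ j, G i j * l j = f i) (hfl : ∑ i, l i * f i = 1)
    (hxl : ∑ i, l i * x i = 0) {P Q : ℝ} {C : ι → ι → ι → ℝ}
    (hC : ∀ i j k, C i j k = P * ((G i j - f i * f j) * x k + (G j k - f j * f k) * x i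
      + (G i k - f i * f k) * x j) + Q * (x i * x j * x k)) {τ : ℝ}
    (hτ : τ = ∑ i, ∑ j, G⁻¹ i j * x i * x j) :
    (∀ i, ∑ j, ∑ k, G⁻¹ j k * C i j k = ((Fintype.card ι + 1) * P + Q * τ) * x i) ∧
    ∑ i, ∑ j, ∑ k, ∑ p, ∑ q, ∑ r, G⁻¹ i p * G⁻¹ j q * G⁻¹ k r * C i j k * C p q r =
      τ * (3 * (Fintype.card ι + 1) * P ^ 2 + 6 * P * Q * τ + Q ^ 2 * τ ^ 2) := by
  set K := G⁻¹ with hK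
  have hu : IsUnit G.det := isUnit_iff_ne_zero.2 hdet
  have hGt : G.transpose = G := Matrix.ext fun i j => hG j i
  have hKs : ∀ i j, K i j = K j i := fun i j => by
    have h : K.transpose = K := by rw [hK, Matrix.transpose_nonsing_inv, hGt]
    exact congrFun (congrFun h.symm i) j
  have hKG : ∀ i j, ∑ k, K i k * G k j = if i = j then 1 else 0 := fun i j => by
    rw [← Matrix.mul_apply, hK, Matrix.nonsing_inv_mul _ hu, Matrix.one_apply]
  have hGK : ∀ i j, ∑ k, G i k * K k j = if i = j then 1 else 0 := fun i j => by
    rw [← Matrix.mul_apply, hK, Matrix.mul_nonsing_inv _ hu, Matrix.one_apply]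
  have hKf : ∀ i, ∑ j, K i j * f j = l i := fun i => by
    simp only [← hl, Finset.mul_sum]
    rw [Finset.sum_comm]
    simp only [← mul_assoc, ← Finset.sum_mul, hKG]
    simp
  obtain ⟨X, hX⟩ : ∃ X : ι → ℝ, ∀ i, ∑ j, K i j * x j = X i := ⟨_, fun _ => rfl⟩
  have hτX : ∑ i, X i * x i = τ := by
    simp only [hτ, ← hX, Finset.sum_mul]
    exact Finset.sum_congr rfl fun i _ => Finset.sum_congr rfl fun j _ => by ring
  have hGX : ∀ i, ∑ j, G i j * X j = x i := fun i => by
    simp only [← hX, Finset.mul_sum]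
    rw [Finset.sum_comm]
    simp only [← mul_assoc, ← Finset.sum_mul, hGK]
    simp
  have hfX : ∑ i, f i * X i = 0 := by
    simp only [← hX, Finset.mul_sum]
    rw [Finset.sum_comm, ← hxl]
    refine Finset.sum_congr rfl fun j _ => ?_
    rw [← hKf j, Finset.sum_mul]
    exact Finset.sum_congr rfl fun i _ => by rw [hKs i j]; ring
  have hKGt : ∑ i, ∑ j, K i j * G i j = Fintype.card ι := by
    have h : ∀ i, ∑ j, K i j * G i j = 1 := fun i => by
      have := hKG i i
      simp only [if_true] at this
      rw [← this]
      exact Finset.sum_congr rfl fun j _ => by rw [hG i j]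
    simp [h]
  -- `h` and `H` are the form and its inverse with the direction of `f` removed. They are mutually
  -- inverse on the complement, of dimension `card ι - 1`, and `N` below is the projection onto it.
  obtain ⟨h, hh⟩ : ∃ h : ι → ι → ℝ, ∀ i j, h i j = G i j - f i * f j := ⟨_, fun _ _ => rfl⟩
  obtain ⟨H, hH⟩ : ∃ H : ι → ι → ℝ, ∀ i j, H i j = K i j - l i * l j := ⟨_, fun _ _ => rfl⟩
  have hhs : ∀ i j, h i j = h j i := fun i j => by rw [hh, hh, hG i j]; ring
  have hHs : ∀ i j, H i j = H j i := fun i j => by rw [hH, hH, hKs i j]; ring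
  have hhX : ∀ i, ∑ j, h i j * X j = x i := fun i => by
    simp only [hh, sub_mul, Finset.sum_sub_distrib, hGX, mul_assoc, ← Finset.mul_sum, hfX]
    ring
  have hHx : ∀ i, ∑ j, H i j * x j = X i := fun i => by
    simp only [hH, sub_mul, Finset.sum_sub_distrib, hX, mul_assoc, ← Finset.mul_sum, hxl]
    ring
  obtain ⟨N, hN⟩ : ∃ N : ι → ι → ℝ, ∀ i j, N i j = (if i = j then 1 else 0) - l i * f j :=
    ⟨_, fun _ _ => rfl⟩
  have hKh : ∀ i j, ∑ k, K i k * h j k = N i j := fun i j => by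
    rw [hN, ← hKG, ← hKf, Finset.sum_mul, ← Finset.sum_sub_distrib]
    exact Finset.sum_congr rfl fun k _ => by rw [hh, hG j k]; ring
  have hKN : ∀ i j, ∑ k, K i k * N j k = H i j := fun i j => by
    simp only [hN, mul_sub, Finset.sum_sub_distrib]
    rw [hH, ← hKf i, Finset.sum_mul]
    congr 1
    · simp
    · exact Finset.sum_congr rfl fun k _ => by ring
  have hKht : ∑ i, ∑ j, K i j * h i j = Fintype.card ι - 1 := by
    simp only [hh, mul_sub, Finset.sum_sub_distrib, hKGt]
    rw [← hfl]
    congr 1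
    refine Finset.sum_congr rfl fun i _ => ?_
    rw [← hKf i, Finset.sum_mul]
    exact Finset.sum_congr rfl fun j _ => by ring
  have hlh : ∀ i, ∑ j, l j * h i j = 0 := fun i => by
    have h1 : ∑ j, l j * h i j = ∑ j, G i j * l j - f i * ∑ j, l j * f j := by
      rw [Finset.mul_sum, ← Finset.sum_sub_distrib]
      exact Finset.sum_congr rfl fun j _ => by rw [hh]; ring
    rw [h1, hl, hfl]
    ring
  have hHht : ∑ i, ∑ j, H i j * h i j = Fintype.card ι - 1 := by
    rw [← hKht]
    refine Finset.sum_congr rfl fun i _ => ?_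
    have h1 : ∑ j, H i j * h i j = ∑ j, K i j * h i j - l i * ∑ j, l j * h i j := by
      rw [Finset.mul_sum, ← Finset.sum_sub_distrib]
      exact Finset.sum_congr rfl fun j _ => by rw [hH]; ring
    rw [h1, hlh]
    ring
  have hC' : ∀ i j k, C i j k = P * (h i j * x k + h j k * x i + h i k * x j)
      + Q * (x i * x j * x k) := fun i j k => by rw [hC, hh, hh, hh]
  -- Stated for a general `T` because it is needed twice: with `T = K` for the mean torsion, and
  -- with `T = H` inside the full contraction.
  have htr : ∀ T : ι → ι → ℝ, (∑ i, ∑ j, T i j * h i j = Fintype.card ι - 1) →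
      (∀ i, ∑ j, T i j * x j = X i) → (∀ i j, T i j = T j i) →
      ∀ i, ∑ j, ∑ k, T j k * C i j k = ((Fintype.card ι + 1) * P + Q * τ) * x i := by
    intro T h1 h2 h3 i
    have e1 : ∀ j, ∑ k, T j k * C i j k = P * (h i j * X j + (∑ k, T j k * h j k) * x i
        + (∑ k, h i k * T k j) * x j) + Q * (x i * (X j * x j)) := fun j => by
      rw [← h2 j]
      simp only [Finset.mul_sum, Finset.sum_mul, ← Finset.sum_add_distrib]
      exact Finset.sum_congr rfl fun k _ => by rw [hC', h3 k j]; ring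
    have e2 : ∑ j, (∑ k, h i k * T k j) * x j = x i := by
      simp only [Finset.sum_mul]
      rw [Finset.sum_comm]
      simp only [mul_assoc, ← Finset.mul_sum, h2, hhX]
    simp only [e1, Finset.sum_add_distrib, ← Finset.mul_sum, e2, hhX, ← Finset.sum_mul, h1, hτX]
    ring
  refine ⟨htr K hKht hX hKs, ?_⟩
  -- Indices are raised one at a time: `h` turns into `N` and then into `H`, while `x` turns into
  -- `X`.
  have hD1 : ∀ p q k, ∑ r, K k r * C p q r = P * (h p q * X k + N k q * x p + N k p * x q)
      + Q * (x p * x q * X k) := fun p q k => by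
    simp only [← hX k, ← hKh, Finset.mul_sum, Finset.sum_mul, ← Finset.sum_add_distrib]
    exact Finset.sum_congr rfl fun r _ => by rw [hC']; ring
  have hD2 : ∀ p j k, ∑ q, K j q * (P * (h p q * X k + N k q * x p + N k p * x q)
      + Q * (x p * x q * X k)) = P * (N j p * X k + H j k * x p + N k p * X j)
      + Q * (x p * X j * X k) := fun p j k => by
    simp only [← hX j, ← hKh j, ← hKN j, Finset.mul_sum, Finset.sum_mul,
      ← Finset.sum_add_distrib]
    exact Finset.sum_congr rfl fun r _ => by ring
  have hD3 : ∀ i j k, ∑ p, K i p * (P * (N j p * X k + H j k * x p + N k p * X j)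
      + Q * (x p * X j * X k)) = P * (H i j * X k + H j k * X i + H i k * X j)
      + Q * (X i * X j * X k) := fun i j k => by
    simp only [← hX i, ← hKN i, Finset.mul_sum, Finset.sum_mul, ← Finset.sum_add_distrib]
    exact Finset.sum_congr rfl fun r _ => by ring
  have hD : ∀ i j k, ∑ p, ∑ q, ∑ r, K i p * K j q * K k r * C i j k * C p q r =
      (P * (H i j * X k + H j k * X i + H i k * X j) + Q * (X i * X j * X k)) * C i j k :=
    fun i j k => by
      rw [← hD3]
      simp only [← hD2, ← hD1, Finset.mul_sum, Finset.sum_mul]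
      exact Finset.sum_congr rfl fun _ _ => Finset.sum_congr rfl fun _ _ =>
        Finset.sum_congr rfl fun _ _ => by ring
  have hCs : ∀ i j k, C i j k = C j i k := fun i j k => by rw [hC', hC', hhs i j]; ring
  have hE : ∀ i j, ∑ k, X k * C i j k = P * (h i j * τ + 2 * (x i * x j))
      + Q * τ * (x i * x j) := fun i j => by
    have e : ∑ k, X k * C i j k = P * (h i j * (∑ k, X k * x k) + (∑ k, h j k * X k) * x i
        + (∑ k, h i k * X k) * x j) + Q * (∑ k, X k * x k) * (x i * x j) := by
      simp only [Finset.mul_sum, Finset.sum_mul, ← Finset.sum_add_distrib]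
      exact Finset.sum_congr rfl fun k _ => by rw [hC']; ring
    rw [e, hτX, hhX, hhX]
    ring
  have hI := htr H hHht hHx hHs
  have t1 : ∑ i, ∑ j, H i j * ∑ k, X k * C i j k =
      ((Fintype.card ι + 1) * P + Q * τ) * τ := by
    have e1 : ∀ i, ∑ j, H i j * (P * (h i j * τ + 2 * (x i * x j)) + Q * τ * (x i * x j)) =
        P * τ * (∑ j, H i j * h i j) + (2 * P + Q * τ) * ((∑ j, H i j * x j) * x i) :=
      fun i => by
        simp only [Finset.mul_sum, Finset.sum_mul, ← Finset.sum_add_distrib]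
        exact Finset.sum_congr rfl fun k _ => by ring
    simp only [hE, e1, hHx, Finset.sum_add_distrib, ← Finset.mul_sum, hHht, hτX]
    ring
  have t2 : ∑ i, X i * ∑ j, ∑ k, H j k * C i j k =
      ((Fintype.card ι + 1) * P + Q * τ) * τ := by
    simp only [hI, mul_left_comm (X _), ← Finset.mul_sum, hτX]
  have t4 : ∑ i, X i * ∑ j, X j * ∑ k, X k * C i j k = 3 * P * τ ^ 2 + Q * τ ^ 3 := by
    have e1 : ∀ i, ∑ j, X j * (P * (h i j * τ + 2 * (x i * x j)) + Q * τ * (x i * x j)) =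
        P * τ * (∑ j, h i j * X j) + (2 * P + Q * τ) * ((∑ j, X j * x j) * x i) :=
      fun i => by
        simp only [Finset.mul_sum, Finset.sum_mul, ← Finset.sum_add_distrib]
        exact Finset.sum_congr rfl fun k _ => by ring
    have e2 : ∀ i, X i * (P * τ * x i + (2 * P + Q * τ) * (τ * x i)) =
        (P * τ + (2 * P + Q * τ) * τ) * (X i * x i) := fun i => by ring
    simp only [hE, e1, hhX, hτX, e2, ← Finset.mul_sum]
    ring
  have t3 : ∑ i, ∑ j, ∑ k, H i k * X j * C i j k = ∑ i, X i * ∑ j, ∑ k, H j k * C i j k := by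
    rw [Finset.sum_comm]
    simp only [Finset.mul_sum]
    exact Finset.sum_congr rfl fun j _ => Finset.sum_congr rfl fun i _ =>
      Finset.sum_congr rfl fun k _ => by rw [hCs i j]; ring
  have hS : ∑ i, ∑ j, ∑ k, (P * (H i j * X k + H j k * X i + H i k * X j)
      + Q * (X i * X j * X k)) * C i j k =
      P * (∑ i, ∑ j, H i j * ∑ k, X k * C i j k + ∑ i, X i * ∑ j, ∑ k, H j k * C i j k
        + ∑ i, ∑ j, ∑ k, H i k * X j * C i j k)
        + Q * ∑ i, X i * ∑ j, X j * ∑ k, X k * C i j k := by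
    simp only [Finset.mul_sum, ← Finset.sum_add_distrib]
    exact Finset.sum_congr rfl fun _ _ => Finset.sum_congr rfl fun _ _ =>
      Finset.sum_congr rfl fun _ _ => by ring
  simp only [hD]
  rw [hS, t3, t1, t2, t4]
  ring

end Contraction

/-! ### Positivity of the three denominators. -/

section Fibre

variable {V : Type*} [AddCommGroup V] [Module ℝ V]

theorem isLinearMap_ratioD (a : LinearMap.BilinForm ℝ V) (b : V →ₗ[ℝ] ℝ) (y : V) :
    IsLinearMap ℝ (ratioD a b y) where
  map_add u v := by simp [ratioD, normD]; ring
  map_smul r u := by simp [ratioD, normD]; ring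

/-- The fundamental form of `metric` at `y`, as a bilinear form. -/
def fundForm (a : LinearMap.BilinForm ℝ V) (b : V →ₗ[ℝ] ℝ) (c₁ c₂ c₃ : ℝ) (y : V) :
    LinearMap.BilinForm ℝ V :=
  LinearMap.mk₂ ℝ (fun u v => metricD a b c₁ c₂ c₃ y u * metricD a b c₁ c₂ c₃ y v
      + angularF a b c₁ c₂ c₃ y u v)
    (fun u u' v => by simp [metricD, angularF, angular, normD, ratioD]; ring)
    (fun r u v => by simp [metricD, angularF, angular, normD, ratioD]; ring)
    (fun u v v' => by simp [metricD, angularF, angular, normD, ratioD]; ring)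
    (fun r u v => by simp [metricD, angularF, angular, normD, ratioD]; ring)

theorem det_gram_ne_zero {ι : Type*} [Fintype ι] [DecidableEq ι] (e : Module.Basis ι ℝ V)
    {B : LinearMap.BilinForm ℝ V} (hpos : ∀ u, u ≠ 0 → 0 < B u u) :
    (Matrix.of fun i j => B (e i) (e j)).det ≠ 0 := by
  intro h
  obtain ⟨v, hv, h0⟩ := Matrix.exists_mulVec_eq_zero_iff.2 h
  have hu : e.equivFun.symm v ≠ 0 := fun h => hv (e.equivFun.symm.map_eq_zero_iff.1 h)
  have h1 := hpos _ hu
  have h2 : B (e.equivFun.symm v) (e.equivFun.symm v) = ∑ i, v i * ∑ j, B (e i) (e j) * v j := by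
    simp only [Module.Basis.equivFun_symm_apply, map_sum, map_smul, LinearMap.sum_apply,
      LinearMap.smul_apply, smul_eq_mul, Finset.mul_sum]
    rw [Finset.sum_comm]
    exact Finset.sum_congr rfl fun _ _ => Finset.sum_congr rfl fun _ _ => by ring
  have h3 : ∀ i, ∑ j, B (e i) (e j) * v j = 0 := fun i => congrFun h0 i
  rw [h2] at h1
  simp only [h3, mul_zero, Finset.sum_const_zero, lt_irrefl] at h1

variable {a : LinearMap.BilinForm ℝ V} (hsymm : ∀ u v, a u v = a v u)
  (hpos : ∀ u, u ≠ 0 → 0 < a u u) (b : V →ₗ[ℝ] ℝ) (c₁ c₂ c₃ : ℝ)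

include hsymm hpos

/-- The dual vector of a covector, and its norm in components. -/
theorem exists_dual {n : ℕ} (e : Module.Basis (Fin n) ℝ V) :
    ∃ z : V, (∀ u, a z u = b u) ∧
      b z = ∑ i, ∑ j, (Matrix.of fun k l => a (e k) (e l))⁻¹ i j * b (e i) * b (e j) := by
  set A := Matrix.of fun k l => a (e k) (e l) with hA
  have hdet := isUnit_iff_ne_zero.2 (det_gram_ne_zero e hpos)
  refine ⟨∑ i, (∑ j, A⁻¹ i j * b (e j)) • e i, fun u => ?_, ?_⟩
  · suffices h : a (∑ i, (∑ j, A⁻¹ i j * b (e j)) • e i) = b from LinearMap.congr_fun h u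
    refine e.ext fun k => ?_
    simp only [map_sum, map_smul, LinearMap.sum_apply, LinearMap.smul_apply, smul_eq_mul]
    have h : (A * A⁻¹).mulVec (fun j => b (e j)) k = b (e k) := by
      rw [Matrix.mul_nonsing_inv _ hdet, Matrix.one_mulVec]
    rw [← h, ← Matrix.mulVec_mulVec]
    refine Finset.sum_congr rfl fun i _ => ?_
    rw [hsymm, mul_comm]
    rfl
  · simp only [map_sum, map_smul, smul_eq_mul, Finset.sum_mul]
    exact Finset.sum_congr rfl fun _ _ => Finset.sum_congr rfl fun _ _ => by ring

omit hsymm in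
theorem ratioD_self {y : V} (hy : y ≠ 0) : ratioD a b y y = 0 := by
  have h0 := (formNorm_pos hpos hy).ne'
  simp only [ratioD, ratio, normD, ← formNorm_sq hpos hy]
  field_simp
  ring

omit hsymm in
theorem normD_self {y : V} (hy : y ≠ 0) : normD a y y = formNorm a y := by
  have h0 := (formNorm_pos hpos hy).ne'
  simp only [normD, ← formNorm_sq hpos hy]
  field_simp

omit hsymm in
theorem angular_self_right {y : V} (hsymm : ∀ u v, a u v = a v u) (hy : y ≠ 0) (u : V) :
    angular a y u y = 0 := by
  have h0 := (formNorm_pos hpos hy).ne'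
  rw [angular, normD_self hpos hy, normD, hsymm]
  field_simp
  ring

omit hsymm in
theorem metricD_self {y : V} (hy : y ≠ 0) :
    metricD a b c₁ c₂ c₃ y y = phi a b c₁ c₂ c₃ y * formNorm a y := by
  have h : b y = ratio a b y * formNorm a y := by
    have h0 := (formNorm_pos hpos hy).ne'
    simp only [ratio]
    field_simp
  rw [metricD, normD_self hpos hy, h, phi]
  ring

theorem angularF_self_right {y : V} (hy : y ≠ 0) (u : V) :
    angularF a b c₁ c₂ c₃ y u y = 0 := by
  rw [angularF, angular_self_right hpos hsymm hy, ratioD_self hpos b hy]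
  ring

/-- Positivity of the angular form on vectors that are `a`-orthogonal to `y`. -/
theorem angularF_pos {y u : V} (hy : y ≠ 0) (hu : u ≠ 0) (hyu : a y u = 0)
    (hphi : 0 < phi a b c₁ c₂ c₃ y)
    (hg : ∀ u, u ≠ 0 → 0 < fundForm a b c₁ c₂ c₃ y u u) :
    0 < angularF a b c₁ c₂ c₃ y u u := by
  have h0 := formNorm_pos hpos hy
  -- A vector `a`-orthogonal to `y` need not be `g`-orthogonal to it. This `t` makes `metricD`
  -- vanish on `u - t y`, and the angular form does not see the multiple of `y`.
  obtain ⟨t, ht⟩ : ∃ t : ℝ, t = metricD a b c₁ c₂ c₃ y u / (phi a b c₁ c₂ c₃ y * formNorm a y) :=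
    ⟨_, rfl⟩
  have h1 : u - t • y ≠ 0 := fun h => by
    have h2 : t * a y y = 0 := by simpa [hyu] using congrArg (a y) (sub_eq_zero.1 h).symm
    have h3 : t = 0 := (mul_eq_zero.1 h2).resolve_right (hpos y hy).ne'
    exact hu (by simpa [h3] using h)
  have h2 := hg _ h1
  have h3 : ∀ u v, fundForm a b c₁ c₂ c₃ y u v = metricD a b c₁ c₂ c₃ y u *
    metricD a b c₁ c₂ c₃ y v + angularF a b c₁ c₂ c₃ y u v := fun _ _ => rfl
  have h4 : angularF a b c₁ c₂ c₃ y y u = 0 := by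
    rw [← angularF_self_right hsymm hpos b c₁ c₂ c₃ hy u]
    simp only [angularF, angular, hsymm y u]
    ring
  simp only [map_sub, map_smul, LinearMap.sub_apply, LinearMap.smul_apply, smul_eq_mul, h3,
    angularF_self_right hsymm hpos b c₁ c₂ c₃ hy, h4, metricD_self hpos b c₁ c₂ c₃ hy] at h2
  have h5 : metricD a b c₁ c₂ c₃ y u = t * (phi a b c₁ c₂ c₃ y * formNorm a y) := by
    rw [ht]
    have := hphi.ne'
    have := h0.ne'
    field_simp
  rw [h5] at h2
  linarith

/-- Nonnegativity of `F` gives `φ ≥ 0`, and `g_y(y,y) = F²` excludes zero. -/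
theorem phi_pos {y : V} (hy : y ≠ 0) (hL : 0 ≤ metric a b c₁ c₂ c₃ y)
    (hg : ∀ u, u ≠ 0 → 0 < fundForm a b c₁ c₂ c₃ y u u) : 0 < phi a b c₁ c₂ c₃ y := by
  have h0 := formNorm_pos hpos hy
  have h1 : fundForm a b c₁ c₂ c₃ y y y = metricD a b c₁ c₂ c₃ y y *
    metricD a b c₁ c₂ c₃ y y + angularF a b c₁ c₂ c₃ y y y := rfl
  rw [angularF_self_right hsymm hpos b c₁ c₂ c₃ hy, metricD_self hpos b c₁ c₂ c₃ hy] at h1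
  have h2 := hg y hy
  rw [metric_eq hpos b c₁ c₂ c₃ hy] at hL
  refine lt_of_le_of_ne (nonneg_of_mul_nonneg_left hL h0) fun h => ?_
  rw [← h] at h1
  simp [h1] at h2

omit hsymm hpos in
theorem exists_ne_zero_apply_eq_zero {n : ℕ} (hn : 2 ≤ n) (e : Module.Basis (Fin n) ℝ V)
    (f : V →ₗ[ℝ] ℝ) : ∃ u, u ≠ 0 ∧ f u = 0 := by
  have := Module.Finite.of_basis e
  have h : Module.finrank ℝ ℝ < Module.finrank ℝ V := by
    rw [Module.finrank_eq_card_basis e, Module.finrank_self, Fintype.card_fin]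
    omega
  obtain ⟨u, hu, h0⟩ := (Submodule.ne_bot_iff _).1 (f.ker_ne_bot_of_finrank_lt h)
  exact ⟨u, h0, hu⟩

omit hsymm hpos in
/-- The `a`-dual of `ratioD`. -/
theorem dual_ratioD {y z : V} (hz : ∀ u, a z u = b u) (u : V) :
    a (z - (ratio a b y / formNorm a y) • y) u = ratioD a b y u := by
  simp [hz, ratioD, normD]
  ring

theorem ratioD_dual {y z : V} (hz : ∀ u, a z u = b u) (hy : y ≠ 0) :
    ratioD a b y (z - (ratio a b y / formNorm a y) • y) = b z - ratio a b y ^ 2 := by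
  have h0 := (formNorm_pos hpos hy).ne'
  simp [ratioD, normD, ratio, hsymm y z, hz, ← formNorm_sq hpos hy]
  field_simp
  ring

theorem orthogonal_dual {y z : V} (hz : ∀ u, a z u = b u) (hy : y ≠ 0) :
    a y (z - (ratio a b y / formNorm a y) • y) = 0 := by
  rw [hsymm, dual_ratioD b hz, ratioD_self hpos b hy]

/-- Cauchy–Schwarz: the gap `b² - s²` is the squared `a`-length of the part of `z` orthogonal to
`y`. -/
theorem ratio_sq_le {y z : V} (hz : ∀ u, a z u = b u) (hy : y ≠ 0) :
    ratio a b y ^ 2 ≤ b z := by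
  rw [← sub_nonneg, ← ratioD_dual hsymm hpos b hz hy, ← dual_ratioD b hz]
  by_cases h : z - (ratio a b y / formNorm a y) • y = 0
  · simp [h]
  · exact (hpos _ h).le

omit hsymm hpos in
theorem angularF_of_orthogonal {y u : V} (hyu : a y u = 0) :
    angularF a b c₁ c₂ c₃ y u u = phi a b c₁ c₂ c₃ y * ((c₁ - c₃ * ratio a b y ^ 2) * a u u
      + 2 * c₃ * ratioD a b y u ^ 2) := by
  simp only [angularF, angular, normD, hyu]
  ring

/-- Positivity of the factor of `det g` that comes from the direction of `β`. -/
theorem detFactor_pos {n : ℕ} (hn : 2 ≤ n) (e : Module.Basis (Fin n) ℝ V) {y z : V}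
    (hz : ∀ u, a z u = b u) (hy : y ≠ 0) (hphi : 0 < phi a b c₁ c₂ c₃ y)
    (hg : ∀ u, u ≠ 0 → 0 < fundForm a b c₁ c₂ c₃ y u u) :
    0 < (c₁ - c₃ * ratio a b y ^ 2) + 2 * (b z - ratio a b y ^ 2) * c₃ := by
  have key : ∀ u, u ≠ 0 → a y u = 0 →
      0 < (c₁ - c₃ * ratio a b y ^ 2) * a u u + 2 * c₃ * ratioD a b y u ^ 2 := fun u hu hyu => by
    have h := angularF_pos hsymm hpos b c₁ c₂ c₃ hy hu hyu hphi hg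
    rw [angularF_of_orthogonal b c₁ c₂ c₃ hyu] at h
    exact pos_of_mul_pos_right h hphi.le
  have hd := dual_ratioD b (y := y) hz
  have hm := ratioD_dual hsymm hpos b hz hy
  have ho := orthogonal_dual hsymm hpos b hz hy
  -- If `z` is parallel to `y`, then `b² = s²` and any vector orthogonal to `y` tests the sign.
  -- Otherwise the orthogonal part of `z` is the test vector, and its value is `b² - s²` times the
  -- factor.
  by_cases h : z - (ratio a b y / formNorm a y) • y = 0
  · obtain ⟨u, hu, hyu⟩ := exists_ne_zero_apply_eq_zero hn e (a y)
    have h1 := key u hu hyu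
    have h2 : ratioD a b y u = 0 := by rw [← hd, h]; simp
    have h3 : b z - ratio a b y ^ 2 = 0 := by rw [← hm, ← hd, h]; simp
    rw [h2] at h1
    rw [h3]
    have h4 := pos_of_mul_pos_left (by simpa using h1) (hpos u hu).le
    linarith
  · have h1 := key _ h ho
    have h2 := hpos _ h
    rw [hd, hm] at h1 h2
    refine pos_of_mul_pos_left (b := b z - ratio a b y ^ 2) ?_ h2.le
    linarith

/-- In dimension two there may be no nonzero vector orthogonal to both `y` and `β`, so other points
of the fibre are used. `Δ > 0` on the kernel of `b` gives `c₁ + 2c₃b² > 0`, and at `z` it gives `c₁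
- c₃b² > 0`. As `0 ≤ s² ≤ b²`, one of the two suffices for each sign of `c₃`. -/
theorem phi_sub_pos {n : ℕ} (hn : 2 ≤ n) (e : Module.Basis (Fin n) ℝ V) {z : V}
    (hz : ∀ u, a z u = b u)
    (hD : ∀ y, y ≠ 0 → 0 < (c₁ - c₃ * ratio a b y ^ 2) + 2 * (b z - ratio a b y ^ 2) * c₃)
    {y : V} (hy : y ≠ 0) : 0 < c₁ - c₃ * ratio a b y ^ 2 := by
  obtain ⟨u, hu, hbu⟩ := exists_ne_zero_apply_eq_zero hn e b
  have h1 := hD u hu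
  have h2 : ratio a b u = 0 := by simp [ratio, hbu]
  rw [h2] at h1
  have h3 := ratio_sq_le hsymm hpos b hz hy
  have h4 : 0 < c₁ - c₃ * b z := by
    by_cases h : z = 0
    · simp [h] at h1 ⊢
      linarith
    · have h5 := hD z h
      have h6 : ratio a b z ^ 2 = b z := by
        have h0 := formNorm_sq hpos h
        rw [hz] at h0
        have := (formNorm_pos hpos h).ne'
        rw [ratio, ← h0]
        field_simp
      rw [h6] at h5
      linarith
  rcases le_total 0 c₃ with hc | hc
  · nlinarith
  · nlinarith [sq_nonneg (ratio a b y)]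

end Fibre

/-! ### The scalars `λ`, `τ`, `p`, `q` and the norms at a point. -/

/-- The coefficient of the mean Cartan torsion, in terms of `coeffA`. -/
theorem coeffA_eq (n : ℕ) {c₁ c₂ c₃ B s α ψ φ Δ : ℝ} (hα : α ≠ 0) (hψ : c₁ - c₃ * s ^ 2 = ψ)
    (hφ : c₁ + c₂ * s + c₃ * s ^ 2 = φ) (hΔ : ψ + 2 * (B - s ^ 2) * c₃ = Δ)
    (hψ0 : ψ ≠ 0) (hφ0 : φ ≠ 0) (hΔ0 : Δ ≠ 0) :
    ((n : ℝ) + 1) * (1 / (2 * α) *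
        ((c₁ * c₂ - 3 * c₂ * c₃ * s ^ 2 - 4 * c₃ ^ 2 * s ^ 3) / (φ * ψ))) +
      1 / (2 * α) * (12 * c₃ ^ 2 * s / ψ) * ((B - s ^ 2) / (φ * Δ)) * φ =
      -(coeffA n c₁ c₂ c₃ B s) / (2 * α) := by
  have hc : c₁ = ψ + c₃ * s ^ 2 := by rw [← hψ]; ring
  rw [coeffA, hφ, hψ, hΔ]
  field_simp
  rw [← hΔ, ← hφ, hc]
  ring

/-- The contractions of the Cartan torsion of `metric` at a point. -/
theorem sum_cartanForm_metric {V : Type*} [AddCommGroup V] [Module ℝ V] {n : ℕ}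
    (e : Module.Basis (Fin n) ℝ V) {a : LinearMap.BilinForm ℝ V}
    (hsymm : ∀ u v, a u v = a v u) (hpos : ∀ u, u ≠ 0 → 0 < a u u) (b : V →ₗ[ℝ] ℝ)
    (c₁ c₂ c₃ : ℝ) {y z : V} (hy : y ≠ 0) (hz : ∀ u, a z u = b u)
    (hg : ∀ u, u ≠ 0 → 0 < fundForm a b c₁ c₂ c₃ y u u) {α s φ ψ Δ : ℝ}
    (hα : formNorm a y = α) (hs : ratio a b y = s) (hφ : c₁ + c₂ * s + c₃ * s ^ 2 = φ)
    (hψ : c₁ - c₃ * s ^ 2 = ψ) (hΔ : ψ + 2 * (b z - s ^ 2) * c₃ = Δ)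
    (hφ0 : φ ≠ 0) (hψ0 : ψ ≠ 0) (hΔ0 : Δ ≠ 0)
    {K : Matrix (Fin n) (Fin n) ℝ}
    (hK : K = (Matrix.of fun i j => halfHessSq (metric a b c₁ c₂ c₃) y (e i) (e j))⁻¹)
    {C : Fin n → Fin n → Fin n → ℝ}
    (hC : C = fun i j k => cartanForm (metric a b c₁ c₂ c₃) y (e i) (e j) (e k))
    {P Q τ : ℝ} (hP : P = 1 / (2 * α) *
      ((c₁ * c₂ - 3 * c₂ * c₃ * s ^ 2 - 4 * c₃ ^ 2 * s ^ 3) / (φ * ψ)))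
    (hQ : Q = 1 / (2 * α) * (12 * c₃ ^ 2 * s / ψ) * φ) (hτ : τ = (b z - s ^ 2) / (φ * Δ)) :
    ∑ i, ∑ j, K i j * (∑ k, ∑ l, K k l * C i k l) * (∑ k, ∑ l, K k l * C j k l) =
      τ * ((n + 1) * P + Q * τ) ^ 2 ∧
    ∑ i, ∑ j, ∑ k, ∑ p, ∑ q, ∑ r, K i p * K j q * K k r * C i j k * C p q r =
      τ * (3 * (n + 1) * P ^ 2 + 6 * P * Q * τ + Q ^ 2 * τ ^ 2) := by
  have hα0 : α ≠ 0 := hα ▸ (formNorm_pos hpos hy).ne'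
  have hphi : phi a b c₁ c₂ c₃ y = φ := by rw [phi, hs, hφ]
  have hgapp : ∀ u v, fundForm a b c₁ c₂ c₃ y u v = metricD a b c₁ c₂ c₃ y u *
    metricD a b c₁ c₂ c₃ y v + angularF a b c₁ c₂ c₃ y u v := fun _ _ => rfl
  obtain ⟨G, hG⟩ : ∃ G : Matrix (Fin n) (Fin n) ℝ,
    G = Matrix.of fun i j => fundForm a b c₁ c₂ c₃ y (e i) (e j) := ⟨_, rfl⟩
  have hGapp : ∀ i j, G i j = fundForm a b c₁ c₂ c₃ y (e i) (e j) := fun i j => by rw [hG]; rfl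
  have hKG : K = G⁻¹ := by
    rw [hK, hG]
    simp only [halfHessSq_metric hsymm hpos b c₁ c₂ c₃ hy, hgapp]
  have hdet : G.det ≠ 0 := hG ▸ det_gram_ne_zero e hg
  have hGs : ∀ i j, G i j = G j i := fun i j => by
    simp only [hGapp, hgapp, angularF, angular, hsymm (e i) (e j)]
    ring
  obtain ⟨f, hf⟩ : ∃ f : Fin n → ℝ, ∀ i, f i = metricD a b c₁ c₂ c₃ y (e i) := ⟨_, fun _ => rfl⟩
  obtain ⟨x, hx⟩ : ∃ x : Fin n → ℝ, ∀ i, x i = ratioD a b y (e i) := ⟨_, fun _ => rfl⟩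
  have hsum : ∀ (T : V →ₗ[ℝ] ℝ) (u : V), ∑ j, T (e j) * e.repr u j = T u := fun T u => by
    conv_rhs => rw [← e.sum_repr u]
    simp only [map_sum, map_smul, smul_eq_mul, mul_comm]
  have hGy : ∀ i, ∑ j, G i j * e.repr y j = φ * α * f i := fun i => by
    simp only [hGapp, hsum]
    rw [hgapp, angularF_self_right hsymm hpos b c₁ c₂ c₃ hy, metricD_self hpos b c₁ c₂ c₃ hy,
      hphi, hα, hf]
    ring
  have hFL : IsLinearMap ℝ (metricD a b c₁ c₂ c₃ y) :=
    ⟨fun u v => by simp [metricD, normD]; ring, fun r u => by simp [metricD, normD]; ring⟩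
  have hfy : ∑ j, f j * e.repr y j = φ * α := by
    have h := hsum hFL.mk' y
    simp only [IsLinearMap.mk'_apply, metricD_self hpos b c₁ c₂ c₃ hy, hphi, hα] at h
    rw [← h]
    exact Finset.sum_congr rfl fun j _ => by rw [hf]
  have hxsum : ∀ u, ∑ j, x j * e.repr u j = ratioD a b y u := fun u => by
    have h := hsum (isLinearMap_ratioD a b y).mk' u
    simp only [IsLinearMap.mk'_apply] at h
    rw [← h]
    exact Finset.sum_congr rfl fun j _ => by rw [hx]
  have hFα : φ * α ≠ 0 := mul_ne_zero hφ0 hα0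
  -- The unit vector `y/F` in coordinates, since `F = φα`.
  obtain ⟨l, hl⟩ : ∃ l : Fin n → ℝ, ∀ i, l i = e.repr y i / (φ * α) := ⟨_, fun _ => rfl⟩
  have hGl : ∀ i, ∑ j, G i j * l j = f i := fun i => by
    simp only [hl, mul_div_assoc', ← Finset.sum_div, hGy]
    field_simp
  have hlsum : ∀ v : Fin n → ℝ,
      ∑ i, l i * v i = (∑ i, v i * e.repr y i) / (φ * α) := fun v => by
    rw [Finset.sum_div]
    exact Finset.sum_congr rfl fun i _ => by rw [hl]; ring
  have hfl : ∑ i, l i * f i = 1 := by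
    rw [hlsum, hfy, div_self hFα]
  have hxl : ∑ i, l i * x i = 0 := by
    rw [hlsum, hxsum, ratioD_self hpos b hy, zero_div]
  have hangF : ∀ u v, angularF a b c₁ c₂ c₃ y u v = φ * (ψ * angular a y u v
      + 2 * c₃ * ratioD a b y u * ratioD a b y v) := fun u v => by
    rw [angularF, hphi, hs, hψ]
  have hang : ∀ i j, angular a y (e i) (e j) =
      (G i j - f i * f j - 2 * c₃ * φ * x i * x j) / (φ * ψ) := fun i j => by
    rw [hGapp, hgapp, hf, hf, hx, hx, hangF]
    field_simp
    ring
  -- Eliminating `angular` adds a cubic term in `x`; combined with the one already present, its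
  -- coefficient simplifies to `12c₃²sφ/ψ`, up to the factor `1/(2α)`.
  have hCx : ∀ i j k, C i j k = P * ((G i j - f i * f j) * x k + (G j k - f j * f k) * x i
      + (G i k - f i * f k) * x j) + Q * (x i * x j * x k) := fun i j k => by
    rw [hC, hP, hQ]
    simp only [cartanForm_metric hsymm hpos b c₁ c₂ c₃ hy, hang, hα, hs, ← hx, hGs k i]
    rw [← hψ] at hψ0 ⊢
    rw [← hφ] at hφ0 ⊢
    field_simp
    ring
  obtain ⟨w, hw⟩ : ∃ w, w = z - (ratio a b y / formNorm a y) • y := ⟨_, rfl⟩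
  have hwa : ∀ u, a w u = ratioD a b y u := fun u => hw ▸ dual_ratioD b hz u
  have hwm : ratioD a b y w = b z - s ^ 2 := by
    rw [hw, ratioD_dual hsymm hpos b hz hy, hs]
  have hyw : a y w = 0 := hw ▸ orthogonal_dual hsymm hpos b hz hy
  have hnw : normD a y w = 0 := by rw [normD, hyw, zero_div]
  have hbw : b w = b z - s ^ 2 := by rw [← hwm, ratioD, hnw]; ring
  -- Lowering `w` with `g` gives a combination of `f` and `x`. Applying `G⁻¹` and pairing with `x`,
  -- which kills `l`, isolates `τ`.
  have hGw : ∀ i, ∑ j, G i j * e.repr w j =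
      (b z - s ^ 2) * (c₂ + 2 * c₃ * s) * f i + φ * Δ * x i := fun i => by
    simp only [hGapp, hsum]
    rw [hgapp, hangF, hf, hx, angular, hnw, hsymm, hwa, hwm, ← hΔ]
    rw [show metricD a b c₁ c₂ c₃ y w = (c₂ + 2 * c₃ * s) * (b z - s ^ 2) by
      rw [metricD, hnw, hbw, hs]; ring]
    ring
  have hτ' : τ = ∑ i, ∑ j, G⁻¹ i j * x i * x j := by
    have hu : IsUnit G.det := isUnit_iff_ne_zero.2 hdet
    have hinv : ∀ (v v' : Fin n → ℝ), (∀ i, ∑ j, G i j * v j = v' i) →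
        ∀ i, ∑ j, G⁻¹ i j * v' j = v i := fun v v' h i => by
      have h1 : G.mulVec v = v' := funext h
      have h2 : G⁻¹.mulVec v' = v := by
        rw [← h1, Matrix.mulVec_mulVec, Matrix.nonsing_inv_mul _ hu, Matrix.one_mulVec]
      exact congrFun h2 i
    have h1 := hinv _ _ hGw
    have h2 := hinv _ _ hGl
    have h3 : ∀ i, e.repr w i =
        (b z - s ^ 2) * (c₂ + 2 * c₃ * s) * l i + φ * Δ * ∑ j, G⁻¹ i j * x j := fun i => by
      rw [← h1, ← h2, Finset.mul_sum, Finset.mul_sum, ← Finset.sum_add_distrib]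
      exact Finset.sum_congr rfl fun j _ => by ring
    have h4 := hxsum w
    rw [hwm] at h4
    have h5 : ∑ j, x j * e.repr w j = (b z - s ^ 2) * (c₂ + 2 * c₃ * s) * (∑ i, l i * x i)
        + φ * Δ * ∑ i, ∑ j, G⁻¹ i j * x i * x j := by
      rw [Finset.mul_sum, Finset.mul_sum, ← Finset.sum_add_distrib]
      refine Finset.sum_congr rfl fun i _ => ?_
      rw [h3, mul_add, Finset.mul_sum, Finset.mul_sum, Finset.mul_sum]
      congr 1
      · ring
      · exact Finset.sum_congr rfl fun j _ => by ring
    rw [h4, hxl, mul_zero, zero_add] at h5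
    rw [hτ, h5]
    field_simp
  obtain ⟨hI, hN⟩ := sum_semiCReducible hGs hdet hGl hfl hxl hCx hτ'
  rw [Fintype.card_fin] at hI hN
  rw [hKG]
  refine ⟨?_, hN⟩
  simp only [hI]
  rw [hτ', Finset.sum_mul]
  refine Finset.sum_congr rfl fun i _ => ?_
  rw [Finset.sum_mul]
  exact Finset.sum_congr rfl fun j _ => by ring

/-- The coefficient relating the norms of the Cartan and the mean Cartan torsion. -/
theorem sqrt_mul_sqrt_eq {n : ℕ} (hn : 2 ≤ n) {P Q τ lam p q : ℝ} (hlam : lam = (n + 1) * P + Q * τ)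
    (hlam0 : lam ≠ 0) (hp : p = (n + 1) * P / lam) (hq : q = 1 - p) :
    √(τ * (3 * (n + 1) * P ^ 2 + 6 * P * Q * τ + Q ^ 2 * τ ^ 2)) =
      √((3 * p ^ 2 + 6 * p * q + ((n : ℝ) + 1) * q ^ 2) / ((n : ℝ) + 1)) * √(τ * lam ^ 2) := by
  have hn' : (2 : ℝ) ≤ n := by exact_mod_cast hn
  have hq' : q = Q * τ / lam := by
    rw [hq, hp, eq_div_iff hlam0, sub_mul, div_mul_cancel₀ _ hlam0, hlam]
    ring
  have h0 : 0 ≤ (3 * p ^ 2 + 6 * p * q + ((n : ℝ) + 1) * q ^ 2) / ((n : ℝ) + 1) := by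
    refine div_nonneg ?_ (by linarith)
    -- The numerator is `3(p + q)² + (n - 2)q²`.
    nlinarith [sq_nonneg (p + q), mul_nonneg (sub_nonneg.2 hn') (sq_nonneg q)]
  rw [← Real.sqrt_mul h0]
  congr 1
  rw [hq', hp]
  have : (n : ℝ) + 1 ≠ 0 := by linarith
  field_simp

end AlphaBeta

end

/-! ### The theorem on the manifold. -/

open AlphaBeta
theorem mainTheorem7 {n : ℕ} (hn : 2 ≤ n) {M : Type*} [TopologicalSpace M]
    [ChartedSpace (EuclideanSpace ℝ (Fin n)) M] [IsManifold (𝓡 n) ∞ M]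
    (a : SmoothMetric n M) (β : SmoothOneForm n M) (c₁ c₂ c₃ : ℝ) (F : FinslerMetric n M)
    (hF : ∀ (x : M) (y : TangentSpace (𝓡 n) x),
      F.toFun x y = c₁ * a.alpha x y + c₂ * β.eval x y + c₃ * β.eval x y ^ 2 / a.alpha x y)
    (x : M) (e : Module.Basis (Fin n) ℝ (TangentSpace (𝓡 n) x))
    (y : TangentSpace (𝓡 n) x) (hy : y ≠ 0)
    (s bSq A p q : ℝ) (hs : s = β.eval x y / a.alpha x y) (hb : bSq = β.normSq a x e)
    (hA : A = coeffA n c₁ c₂ c₃ bSq s) (hp : p = coeffP n c₁ c₂ c₃ bSq s) (hq : q = 1 - p) :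
    (c₁ - c₃ * s ^ 2 ≠ 0 ∧ c₁ + c₂ * s + c₃ * s ^ 2 ≠ 0 ∧
      (c₁ - c₃ * s ^ 2) + 2 * (bSq - s ^ 2) * c₃ ≠ 0) ∧
    (F.meanCartanNorm x e y ≠ 0 → A ≠ 0) ∧
    (A ≠ 0 →
      F.cartanNorm x e y =
        Real.sqrt ((3 * p ^ 2 + 6 * p * q + ((n : ℝ) + 1) * q ^ 2) / ((n : ℝ) + 1)) *
          F.meanCartanNorm x e y) ∧
    (c₃ = 0 →
      (c₂ ≠ 0 → A ≠ 0 ∧ p = 1) ∧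
      F.cartanNorm x e y = Real.sqrt (3 / ((n : ℝ) + 1)) * F.meanCartanNorm x e y) := by
  obtain ⟨B, hB⟩ : ∃ B : LinearMap.BilinForm ℝ (TangentSpace (𝓡 n) x),
      ∀ u v, B u v = a.inner x u v :=
    ⟨LinearMap.mk₂ ℝ (fun u v => a.inner x u v) (by simp) (by simp) (by simp) (by simp),
      fun _ _ => rfl⟩
  obtain ⟨b, hbl⟩ : ∃ b : TangentSpace (𝓡 n) x →ₗ[ℝ] ℝ, ∀ u, b u = β.eval x u :=
    ⟨(β x).toLinearMap, fun _ => rfl⟩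
  have hsymm : ∀ u v, B u v = B v u := fun u v => by rw [hB, hB, a.symm]
  have hpos : ∀ u, u ≠ 0 → 0 < B u u := fun u hu => by rw [hB]; exact a.pos x u hu
  have halpha : ∀ u, a.alpha x u = formNorm B u := fun u => by
    rw [SmoothMetric.alpha, formNorm, hB]
  have hFL : F.toFun x = metric B b c₁ c₂ c₃ := funext fun u => by
    rw [hF, halpha, metric, hbl]
  have hg : ∀ y, y ≠ 0 → ∀ u, u ≠ 0 → 0 < fundForm B b c₁ c₂ c₃ y u u := fun y hy u hu => by
    have h := F.posDef x y u hy hu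
    rw [hFL] at h
    have h1 := halfHessSq_metric hsymm hpos b c₁ c₂ c₃ hy u u
    rw [halfHessSq] at h1
    rw [h1] at h
    exact h
  obtain ⟨z, hz, hbz⟩ := exists_dual hsymm hpos b e
  have hbSq : bSq = b z := by
    rw [hb, hbz]
    simp only [SmoothOneForm.normSq, hB, hbl]
  have hsr : ratio B b y = s := by rw [hs, ratio, hbl, halpha]
  have hphi : ∀ y, y ≠ 0 → 0 < phi B b c₁ c₂ c₃ y := fun y hy =>
    phi_pos hsymm hpos b c₁ c₂ c₃ hy (by rw [← hFL]; exact F.nonneg x y) (hg y hy)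
  -- Kept for all nonzero vectors of the fibre, since `phi_sub_pos` evaluates it away from the given
  -- `y`.
  have hD := fun y hy => detFactor_pos hsymm hpos b c₁ c₂ c₃ hn e hz hy (hphi y hy) (hg y hy)
  have hψ0 : c₁ - c₃ * s ^ 2 ≠ 0 := by
    rw [← hsr]
    exact (phi_sub_pos hsymm hpos b c₁ c₃ hn e hz hD hy).ne'
  have hφ0 : c₁ + c₂ * s + c₃ * s ^ 2 ≠ 0 := by
    rw [← hsr]
    exact (hphi y hy).ne'
  have hΔ0 : (c₁ - c₃ * s ^ 2) + 2 * (bSq - s ^ 2) * c₃ ≠ 0 := by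
    rw [← hsr, hbSq]
    exact (hD y hy).ne'
  obtain ⟨α, hα⟩ : ∃ α, α = formNorm B y := ⟨_, rfl⟩
  have hα0 : α ≠ 0 := hα ▸ (formNorm_pos hpos hy).ne'
  obtain ⟨φ, hφ⟩ : ∃ φ, c₁ + c₂ * s + c₃ * s ^ 2 = φ := ⟨_, rfl⟩
  obtain ⟨ψ, hψ⟩ : ∃ ψ, c₁ - c₃ * s ^ 2 = ψ := ⟨_, rfl⟩
  obtain ⟨Δ, hΔ⟩ : ∃ Δ, ψ + 2 * (bSq - s ^ 2) * c₃ = Δ := ⟨_, rfl⟩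
  refine ⟨⟨hψ0, hφ0, hΔ0⟩, ?_⟩
  rw [hψ, hΔ] at hΔ0
  rw [hψ] at hψ0
  rw [hφ] at hφ0
  obtain ⟨P, hP⟩ : ∃ P, P = 1 / (2 * α) *
    ((c₁ * c₂ - 3 * c₂ * c₃ * s ^ 2 - 4 * c₃ ^ 2 * s ^ 3) / (φ * ψ)) := ⟨_, rfl⟩
  obtain ⟨Q, hQ⟩ : ∃ Q, Q = 1 / (2 * α) * (12 * c₃ ^ 2 * s / ψ) * φ := ⟨_, rfl⟩
  obtain ⟨τ, hτ⟩ : ∃ τ, τ = (bSq - s ^ 2) / (φ * Δ) := ⟨_, rfl⟩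
  obtain ⟨lam, hlam⟩ : ∃ lam, lam = ((n : ℝ) + 1) * P + Q * τ := ⟨_, rfl⟩
  obtain ⟨hI, hC⟩ := sum_cartanForm_metric e hsymm hpos b c₁ c₂ c₃ hy hz (hg y hy) hα.symm hsr
    hφ hψ (hbSq ▸ hΔ) hφ0 hψ0 hΔ0 rfl rfl hP hQ (hbSq ▸ hτ)
  have hIn : F.meanCartanNorm x e y = √(τ * lam ^ 2) := by
    rw [hlam, ← hI, ← hFL]
    rfl
  have hCn : F.cartanNorm x e y =
      √(τ * (3 * (n + 1) * P ^ 2 + 6 * P * Q * τ + Q ^ 2 * τ ^ 2)) := by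
    rw [← hC, ← hFL]
    rfl
  have hlamA : lam = -A / (2 * α) := by
    rw [hA, ← coeffA_eq n hα0 hψ hφ hΔ hψ0 hφ0 hΔ0, hlam, hP, hQ, hτ]
    ring
  have hn1 : (n : ℝ) + 1 ≠ 0 := by positivity
  rw [hIn, hCn]
  refine ⟨fun h hA0 => h (by simp [hlamA, hA0]), fun hA0 => ?_, fun hc => ⟨fun hc2 => ?_, ?_⟩⟩
  · have hlam0 : lam ≠ 0 := by
      rw [hlamA]
      exact div_ne_zero (neg_ne_zero.2 hA0) (mul_ne_zero two_ne_zero hα0)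
    refine sqrt_mul_sqrt_eq hn hlam hlam0 ?_ hq
    -- The bracket in `coeffP` is the negative of the one in `P`, which matches the sign in `λ =
    -- -A/(2α)`.
    rw [hp, coeffP, ← hA, hφ, hψ, hP, hlamA]
    field_simp
    ring
  · have hA1 : A = -(((n : ℝ) + 1) * c₂ / φ) := by
      rw [hA, coeffA, hφ, hc]
      ring
    have hA0 : A ≠ 0 := by
      rw [hA1]
      exact neg_ne_zero.2 (div_ne_zero (mul_ne_zero hn1 hc2) hφ0)
    refine ⟨hA0, ?_⟩
    have hc1 : c₁ = ψ := by rw [← hψ, hc]; ring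
    rw [hp, coeffP, ← hA, hφ, hψ, hA1, hc, hc1]
    field_simp
    ring
  -- For a Randers metric `A` may vanish, so nothing is divided by `λ`: with `Q = 0` the squared
  -- norms are `3(n+1)P²τ` and `(n+1)²P²τ`.
  · have hQ0 : Q = 0 := by rw [hQ, hc]; ring
    rw [hlam, hQ0, ← Real.sqrt_mul (by positivity)]
    congr 1
    field_simp
    ring
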